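/- For permutations $\sigma$ of length $k$ and $\pi$ of length $n$, say that $\sigma$ is contained in $\pi$, written $\sigma\le\pi$, if there are indices $i_1<\dots<i_k$ such that $\pi(i_1)\cdots\pi(i_k)$ is order isomorphic to $\sigma(1)\cdots\sigma(k)$. A permutation class is a set of finite permutations that is closed downward under containment. The inversion graph $G_\pi$ of a permutation $\pi$ of length $n$ is the graph on $\{1,\dots,n\}$ in which $i<j$ are adjacent if and only if $\pi(i)>\pi(j)$; for a set $X$ of permutations, $G_X$ is the set of all finite graphs isomorphic to $G_\pi$ for some $\pi\in X$. An interval of $\pi$ is a set of contiguous indices whose set of values under $\pi$ is also contiguous, and $\pi$ is simple if $n\ge 2$ and its only intervals are those of lengths $0$, $1$ and $n$. A set with a quasi-order $\le$ is well-quasi-ordered (wqo) if every infinite sequence $x_1,x_2,\dots$ of its elements contains a pair with $i<j$ and $x_i\le x_j$. **Proposition.** Let $\mathcal{C}$ be a permutation class such that $G_{\mathcal{C}}$ is wqo in the induced subgraph order. Then the set of simple permutations in $\mathcal{C}$ is wqo in the permutation containment order. -/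

import Mathlib

/-- A finite permutation of arbitrary length `n`, written as a bijection of `{0, …, n - 1}`. -/
abbrev FinPerm : Type := Σ n : ℕ, Equiv.Perm (Fin n)

/-- A finite graph, on the vertex set `{0, …, n - 1}`. Every finite graph is isomorphic to one of
these. -/
abbrev FinGraph : Type := Σ n : ℕ, SimpleGraph (Fin n)

namespace FinPerm

/-- The permutation containment order: `σ` is contained in `π` if some subsequence of
`π(1), …, π(n)` is order isomorphic to `σ(1), …, σ(k)`. The strictly increasing map `f` gives the
positions of that subsequence. -/
def Contained (σ π : FinPerm) : Prop :=
  ∃ f : Fin σ.1 → Fin π.1, StrictMono f ∧ ∀ i j, σ.2 i < σ.2 j ↔ π.2 (f i) < π.2 (f j)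

/-- A permutation class: a set of permutations closed downward under containment. -/
def IsClass (C : Set FinPerm) : Prop :=
  ∀ ⦃σ π : FinPerm⦄, π ∈ C → Contained σ π → σ ∈ C

/-- An interval of `π`: a contiguous set of indices whose set of values is also contiguous. -/
def IsInterval (π : FinPerm) (I : Set (Fin π.1)) : Prop :=
  I.OrdConnected ∧ (π.2 '' I).OrdConnected

/-- A permutation is simple if it has length at least two and all of its intervals are trivial,
i.e. have length `0`, `1` or `n`. -/
def IsSimple (π : FinPerm) : Prop :=
  2 ≤ π.1 ∧ ∀ I : Set (Fin π.1), IsInterval π I → I.ncard = 0 ∨ I.ncard = 1 ∨ I.ncard = π.1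

/-- The inversion graph of `π`: its vertices are the indices, and two indices are adjacent when
the corresponding entries of `π` form an inversion. -/
def inversionGraph (π : FinPerm) : SimpleGraph (Fin π.1) where
  Adj i j := (i < j ∧ π.2 j < π.2 i) ∨ (j < i ∧ π.2 i < π.2 j)
  symm := ⟨fun _ _ h => h.symm⟩
  loopless := ⟨fun i h => by rcases h with h | h <;> exact lt_irrefl i h.1⟩

/-- The graphs (up to isomorphism) that are inversion graphs of members of `X`. -/
def graphClass (X : Set FinPerm) : Set FinGraph :=
  {G | ∃ π ∈ X, Nonempty (G.2 ≃g inversionGraph π)}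

end FinPerm

/-- The induced subgraph order on finite graphs. -/
def FinGraph.InducedSubgraph (G H : FinGraph) : Prop :=
  SimpleGraph.IsIndContained G.2 H.2

/-!
For a simple permutation, the inversion graph determines the orders by position and by value up to
exchanging and simultaneously reversing them. Indeed, let a second pair of orders have the same
inversion graph `E`, and let `D` be the set of pairs on which the two position orders disagree.
Colouring pairs by whether they lie outside `E`, in `E \ D` or in `E ∩ D` leaves no triangle with
three colours, so by Gallai some colour class is disconnected. Its components are intervals of both
orders, hence single points by simplicity: one colour does not occur. Apart from permutations of
length two, this says that `D` contains `E` or is disjoint from it. The same holds for the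
complement of `E`, so `D` is `∅`, `E`, its complement or everything.

Therefore an embedding of the inversion graph of a simple `σ` into that of `π` shows that `σ`, its
inverse, its reverse complement or the inverse of its reverse complement is contained in `π`. In an
infinite sequence of permutations, these involutions can be cancelled.
-/

open Set

section InvolutiveAutomorphism

variable {α : Type*} {r : α → α → Prop} {e : α → α}

/-- The relation `r` up to the symmetry `e`, which in the application is an involutive
automorphism of `r`: the left-hand argument may be replaced by its image under `e`. -/
def UpToInvolution (r : α → α → Prop) (e : α → α) (a b : α) : Prop :=
  r a b ∨ r (e a) b

theorem UpToInvolution.isPreorder [IsPreorder α r] (he : Function.Involutive e)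
    (hr : ∀ a b, r a b → r (e a) (e b)) : IsPreorder α (UpToInvolution r e) where
  refl a := .inl (refl a)
  trans := by
    rintro a b c (hab | hab) (hbc | hbc)
    · exact .inl (_root_.trans hab hbc)
    · exact .inr (_root_.trans (hr _ _ hab) hbc)
    · exact .inr (_root_.trans hab hbc)
    · exact .inl (_root_.trans (he a ▸ hr _ _ hab) hbc)

-- Among any three terms of a chain up to `e`, two are related by `r`: if neither consecutive pair
-- is, then the two occurrences of `e` cancel.
theorem partiallyWellOrderedOn_of_upToInvolution [IsPreorder α r] (he : Function.Involutive e)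
    (hr : ∀ a b, r a b → r (e a) (e b)) {s : Set α}
    (hs : s.PartiallyWellOrderedOn (UpToInvolution r e)) : s.PartiallyWellOrderedOn r := by
  have := UpToInvolution.isPreorder he hr
  rw [partiallyWellOrderedOn_iff_exists_lt]
  intro a ha
  obtain ⟨g, hg⟩ := hs.exists_monotone_subseq ha
  have lt_of_lt {m n : ℕ} (hmn : m < n) : g m < g n := g.strictMono hmn
  rcases hg 0 1 zero_le_one with h₀₁ | h₀₁
  · exact ⟨_, _, lt_of_lt zero_lt_one, h₀₁⟩
  rcases hg 1 2 one_le_two with h₁₂ | h₁₂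
  · exact ⟨_, _, lt_of_lt one_lt_two, h₁₂⟩
  · exact ⟨_, _, lt_of_lt zero_lt_two, _root_.trans (he (a (g 0)) ▸ hr _ _ h₀₁) h₁₂⟩

end InvolutiveAutomorphism

section RainbowFree

variable {V W γ : Type*} {col : Sym2 V → γ} {c : γ}

/-- The graph of the pairs of distinct vertices that have colour `c` in the edge colouring `col` of
the complete graph on `V`. The colours of diagonal pairs are irrelevant. -/
def colorGraph (col : Sym2 V → γ) (c : γ) : SimpleGraph V :=
  .fromEdgeSet (col ⁻¹' {c})

theorem colorGraph_adj {x y : V} : (colorGraph col c).Adj x y ↔ col s(x, y) = c ∧ x ≠ y :=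
  SimpleGraph.fromEdgeSet_adj _

theorem colorGraph_comp_map {f : W → V} (hf : Function.Injective f) (col : Sym2 V → γ) (c : γ) :
    colorGraph (col ∘ Sym2.map f) c = (colorGraph col c).comap f := by
  ext x y
  simp [colorGraph_adj, hf.ne_iff]

/-- A Gallai colouring: no triangle has three different colours. Degenerate triangles satisfy the
condition automatically. -/
def RainbowFree (col : Sym2 V → γ) : Prop :=
  ∀ x y z, col s(x, y) = col s(y, z) ∨ col s(y, z) = col s(x, z) ∨ col s(x, y) = col s(x, z)

theorem RainbowFree.comp_map (hr : RainbowFree col) (f : W → V) :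
    RainbowFree (col ∘ Sym2.map f) :=
  fun x y z => hr (f x) (f y) (f z)

theorem color_ne_of_notMem_supp {K : (colorGraph col c).ConnectedComponent} {x y : V}
    (hx : x ∉ K.supp) (hy : y ∈ K.supp) : col s(x, y) ≠ c := fun h =>
  hx <| K.mem_supp_of_adj_mem_supp hy
    (colorGraph_adj.mpr ⟨h, fun hxy => hx (hxy ▸ hy)⟩).symm

theorem RainbowFree.color_eq_of_notMem_supp (hr : RainbowFree col)
    {K : (colorGraph col c).ConnectedComponent} {x y z : V} (hx : x ∉ K.supp) (hy : y ∈ K.supp)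
    (hz : z ∈ K.supp) : col s(x, y) = col s(x, z) := by
  by_contra hyz
  obtain ⟨p⟩ := K.reachable_of_mem_supp hy hz
  obtain ⟨d, -, ⟨hfst, hcol⟩, hsnd⟩ := p.exists_boundary_dart
    {w | w ∈ K.supp ∧ col s(x, y) = col s(x, w)} ⟨hy, rfl⟩ fun h => hyz h.2
  have hsnd_mem : d.snd ∈ K.supp := K.mem_supp_of_adj_mem_supp hfst d.adj
  have hdart : col s(d.fst, d.snd) = c := (colorGraph_adj.mp d.adj).1
  rcases hr x d.fst d.snd with h | h | h
  · exact color_ne_of_notMem_supp hx hfst (h.trans hdart)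
  · exact color_ne_of_notMem_supp hx hsnd_mem (h.symm.trans hdart)
  · exact hsnd ⟨hsnd_mem, hcol.trans h⟩

theorem exists_mem_supp_adj_of_preconnected {G : SimpleGraph V} (hG : G.Preconnected) {v : V}
    (K : (G.induce {v}ᶜ).ConnectedComponent) : ∃ w ∈ K.supp, G.Adj v w := by
  obtain ⟨u, hu⟩ := K.nonempty_supp
  obtain ⟨p⟩ := hG u v
  obtain ⟨d, -, ⟨w, hw, hwd⟩, hsnd⟩ := p.exists_boundary_dart (Subtype.val '' K.supp)
    ⟨u, hu, rfl⟩ fun ⟨w, _, hw⟩ => w.2 hw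
  have hadj : G.Adj w d.snd := hwd ▸ d.adj
  suffices hv : d.snd = v from ⟨w, hw, hv ▸ hadj.symm⟩
  by_contra hv
  exact hsnd ⟨⟨d.snd, hv⟩, K.mem_supp_of_adj_mem_supp hw hadj, rfl⟩

/-- The restriction of an edge colouring to the complement of the vertex `v`. -/
abbrev eraseVertex (col : Sym2 V → γ) (v : V) : Sym2 ↥({v}ᶜ : Set V) → γ :=
  col ∘ Sym2.map Subtype.val

theorem exists_mem_supp_color_eq {v : V} (hc : (colorGraph col c).Preconnected)
    (K : (colorGraph (eraseVertex col v) c).ConnectedComponent) :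
    ∃ w ∈ K.supp, col s(v, ↑w) = c := by
  revert K
  rw [eraseVertex, colorGraph_comp_map Subtype.val_injective]
  intro K
  obtain ⟨w, hw, hadj⟩ := exists_mem_supp_adj_of_preconnected hc K
  exact ⟨w, hw, (colorGraph_adj.mp hadj).1⟩

theorem exists_color_eq_of_preconnected [Nontrivial V] (v : V)
    (hc : (colorGraph col c).Preconnected) : ∃ w : ↥({v}ᶜ : Set V), col s(v, ↑w) = c := by
  obtain ⟨u, hu⟩ := exists_ne v
  obtain ⟨w, -, hw⟩ := exists_mem_supp_color_eq (v := v) hc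
    ((colorGraph (eraseVertex col v) c).connectedComponentMk ⟨u, hu⟩)
  exact ⟨w, hw⟩

-- By connectivity `K` contains a vertex `w` joined to `v` in colour `c`. The triangle `v`, `x`, `w`
-- then determines the colour of `x` and `w`.
theorem RainbowFree.color_eq_color_erased (hr : RainbowFree col) {v : V}
    (hc : (colorGraph col c).Preconnected)
    {K : (colorGraph (eraseVertex col v) c).ConnectedComponent} {x y : ↥({v}ᶜ : Set V)}
    (hx : x ∉ K.supp) (hvx : col s(v, ↑x) ≠ c) (hy : y ∈ K.supp) :
    eraseVertex col v s(x, y) = col s(v, ↑x) := by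
  obtain ⟨w, hw, hvw⟩ := exists_mem_supp_color_eq hc K
  have hxw : eraseVertex col v s(x, w) ≠ c := color_ne_of_notMem_supp hx hw
  refine ((hr.comp_map _).color_eq_of_notMem_supp hx hy hw).trans ?_
  rcases hr v x w with h | h | h
  · exact h.symm
  · exact absurd (h.trans hvw) hxw
  · exact absurd (h.trans hvw) hvx

theorem RainbowFree.exists_not_preconnected_of_eraseVertex [Nontrivial V] (hr : RainbowFree col)
    (hγ : 3 ≤ ENat.card γ) {v : V} (hc : ¬ (colorGraph (eraseVertex col v) c).Preconnected) :
    ∃ d, ¬ (colorGraph col d).Preconnected := by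
  by_contra! hconn
  obtain ⟨a, hac, -⟩ := ENat.exists_ne_ne_of_three_le hγ c c
  obtain ⟨b, hbc, hba⟩ := ENat.exists_ne_ne_of_three_le hγ c a
  obtain ⟨x, rfl⟩ := exists_color_eq_of_preconnected v (hconn a)
  obtain ⟨y, rfl⟩ := exists_color_eq_of_preconnected v (hconn b)
  let component := (colorGraph (eraseVertex col v) c).connectedComponentMk
  have color_eq {p q} (hpq : component p ≠ component q) (hp : col s(v, ↑p) ≠ c) :
      eraseVertex col v s(p, q) = col s(v, ↑p) :=
    hr.color_eq_color_erased (hconn c) (K := component q) hpq hp rfl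
  by_cases hxy : component x = component y
  · obtain ⟨z, hz⟩ : ∃ z, component z ≠ component x := by
      by_contra! h
      exact hc fun p q => SimpleGraph.ConnectedComponent.exact ((h p).trans (h q).symm)
    have hzxy : eraseVertex col v s(z, x) = eraseVertex col v s(z, y) :=
      (hr.comp_map _).color_eq_of_notMem_supp (K := component x) hz rfl hxy.symm
    rw [Sym2.eq_swap, color_eq hz.symm hac, Sym2.eq_swap (a := z), color_eq (hxy ▸ hz.symm) hbc]
      at hzxy
    exact hba hzxy.symm
  · have hcol : eraseVertex col v s(x, y) = eraseVertex col v s(y, x) :=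
      congrArg _ Sym2.eq_swap
    rw [color_eq hxy hac, color_eq (Ne.symm hxy) hbc] at hcol
    exact hba hcol.symm

theorem RainbowFree.exists_not_preconnected [Finite V] [Nontrivial V] (hr : RainbowFree col)
    (hγ : 3 ≤ ENat.card γ) : ∃ c, ¬ (colorGraph col c).Preconnected := by
  induction hn : Nat.card V using Nat.strong_induction_on generalizing V with
  | h n ih =>
    obtain ⟨v⟩ : Nonempty V := inferInstance
    rcases subsingleton_or_nontrivial ↥({v}ᶜ : Set V) with hsub | hnontriv
    · by_contra! hconn
      obtain ⟨a⟩ : Nonempty γ := ⟨col s(v, v)⟩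
      obtain ⟨b, hba, -⟩ := ENat.exists_ne_ne_of_three_le hγ a a
      obtain ⟨x, rfl⟩ := exists_color_eq_of_preconnected v (hconn a)
      obtain ⟨y, rfl⟩ := exists_color_eq_of_preconnected v (hconn b)
      exact hba (by rw [Subsingleton.elim x y])
    · have hcard : Nat.card ↥({v}ᶜ : Set V) < n := hn ▸ Finite.card_subtype_lt (not_not.mpr rfl)
      obtain ⟨c, hc⟩ := ih _ hcard (hr.comp_map Subtype.val) rfl
      exact hr.exists_not_preconnected_of_eraseVertex hγ hc

/-- Each colour class of `col`, directed along `f`, is a transitive relation. -/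
def TransitiveAlong {α : Type*} [LT α] (f : V → α) (col : Sym2 V → γ) : Prop :=
  ∀ ⦃x y z⦄, f x < f y → f y < f z → col s(x, y) = col s(y, z) → col s(x, z) = col s(x, y)

variable {α β : Type*} [LinearOrder α] [LinearOrder β] {f₁ : V ≃ α} {f₂ : V ≃ β}

-- A vertex `v` between two vertices of `K` but outside `K` lies between the ends of an edge of `K`.
-- It is joined to both ends in the same colour, which transitivity forces to be `c`.
theorem RainbowFree.ordConnected_image_supp (hr : RainbowFree col) (ht : TransitiveAlong f₁ col)
    (K : (colorGraph col c).ConnectedComponent) : (f₁ '' K.supp).OrdConnected := by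
  refine ordConnected_of_Ioo ?_
  rintro _ ⟨x, hx, rfl⟩ _ ⟨y, hy, rfl⟩ - w ⟨hxw, hwy⟩
  obtain ⟨v, rfl⟩ := f₁.surjective w
  by_contra hv
  replace hv : v ∉ K.supp := fun h => hv (mem_image_of_mem _ h)
  obtain ⟨p⟩ := K.reachable_of_mem_supp hx hy
  obtain ⟨d, -, ⟨hfst, hlt⟩, hsnd⟩ := p.exists_boundary_dart
    {u | u ∈ K.supp ∧ f₁ u < f₁ v} ⟨hx, hxw⟩ fun h => hwy.not_gt h.2
  have hsnd_mem : d.snd ∈ K.supp := K.mem_supp_of_adj_mem_supp hfst d.adj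
  have hgt : f₁ v < f₁ d.snd := lt_of_le_of_ne (not_lt.mp fun h => hsnd ⟨hsnd_mem, h⟩)
    (f₁.injective.ne fun h => hv (h ▸ hsnd_mem))
  have hcol : col s(d.fst, v) = col s(v, d.snd) := by
    rw [Sym2.eq_swap, hr.color_eq_of_notMem_supp hv hfst hsnd_mem]
  refine color_ne_of_notMem_supp hv hfst ?_
  rw [Sym2.eq_swap, ← ht hlt hgt hcol, (colorGraph_adj.mp d.adj).1]

/-- The permutation that compares the two linear orders on `V` given by `f₁` and `f₂` is simple:
only the trivial sets are intervals of both orders. Orders on fewer than two points are allowed. -/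
def IsSimplePair (f₁ : V ≃ α) (f₂ : V ≃ β) : Prop :=
  ∀ K : Set V, (f₁ '' K).OrdConnected → (f₂ '' K).OrdConnected → K.Subsingleton ∨ K = univ

theorem IsSimplePair.trans_toDual (h : IsSimplePair f₁ f₂) :
    IsSimplePair f₁ (f₂.trans OrderDual.toDual) := by
  intro K h₁ h₂
  refine h K h₁ ?_
  rw [Equiv.coe_trans, image_comp, Equiv.image_eq_preimage_symm] at h₂
  exact ordConnected_dual.mp h₂

theorem IsSimplePair.exists_colorGraph_eq_bot [Finite V] (hsimple : IsSimplePair f₁ f₂)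
    (hr : RainbowFree col) (hγ : 3 ≤ ENat.card γ) (h₁ : TransitiveAlong f₁ col)
    (h₂ : TransitiveAlong f₂ col) : ∃ c, colorGraph col c = ⊥ := by
  rcases subsingleton_or_nontrivial V with hsub | hnontriv
  · obtain ⟨c⟩ : Nonempty γ := (ENat.one_le_card_iff_nonempty γ).mp (le_trans (by norm_num) hγ)
    exact ⟨c, Subsingleton.elim _ _⟩
  obtain ⟨c, hc⟩ := hr.exists_not_preconnected hγ
  refine ⟨c, SimpleGraph.eq_bot_iff_forall_not_adj.mpr fun x y hxy => ?_⟩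
  let K := (colorGraph col c).connectedComponentMk x
  have hy : y ∈ K.supp := K.mem_supp_of_adj_mem_supp rfl hxy
  rcases hsimple K.supp (hr.ordConnected_image_supp h₁ K) (hr.ordConnected_image_supp h₂ K)
    with hK | hK
  · exact hxy.ne (hK rfl hy)
  · exact hc fun p q => K.reachable_of_mem_supp (hK ▸ mem_univ p) (hK ▸ mem_univ q)

end RainbowFree

section Discordance

variable {V α β α' β' : Type*} [LinearOrder α] [LinearOrder β] [LinearOrder α'] [LinearOrder β']

/-- The pairs on which the orders on `V` pulled back along `f` and `g` disagree. For `f` the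
position and `g` the value of an entry of a permutation, this is its inversion graph. -/
def discordanceGraph (f : V → α) (g : V → β) : SimpleGraph V where
  Adj x y := (f x < f y ∧ g y < g x) ∨ (f y < f x ∧ g x < g y)
  symm := ⟨fun _ _ h => h.symm⟩
  loopless := ⟨fun x h => by rcases h with h | h <;> exact lt_irrefl _ h.1⟩

section

variable {f : V → α} {g : V → β} {x y z : V}

theorem discordanceGraph_adj :
    (discordanceGraph f g).Adj x y ↔ (f x < f y ∧ g y < g x) ∨ (f y < f x ∧ g x < g y) :=
  Iff.rfl

theorem discordanceGraph_comm (f : V → α) (g : V → β) :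
    discordanceGraph f g = discordanceGraph g f := by
  ext x y
  simp only [discordanceGraph_adj]
  tauto

theorem discordanceGraph_adj_iff_of_lt (hxy : f x < f y) :
    (discordanceGraph f g).Adj x y ↔ g y < g x := by
  simp [discordanceGraph_adj, hxy, hxy.not_gt]

theorem not_discordanceGraph_adj_iff_of_lt (hg : Function.Injective g) (hxy : f x < f y) :
    ¬ (discordanceGraph f g).Adj x y ↔ g x < g y := by
  rw [discordanceGraph_adj_iff_of_lt hxy, not_lt]
  exact (hg.ne fun h => hxy.ne (congrArg f h)).le_iff_lt

theorem discordanceGraph_toDual (hf : Function.Injective f) (hg : Function.Injective g) :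
    discordanceGraph f (OrderDual.toDual ∘ g) = (discordanceGraph f g)ᶜ := by
  ext x y
  have hfxy := hf.ne (a₁ := x) (a₂ := y)
  have hgxy := hg.ne (a₁ := x) (a₂ := y)
  simp only [discordanceGraph_adj, SimpleGraph.compl_adj, Function.comp_apply,
    OrderDual.toDual_lt_toDual]
  grind

theorem discordanceGraph_eq_symmDiff {h : V → α'} (hf : Function.Injective f)
    (hg : Function.Injective g) (hh : Function.Injective h) :
    discordanceGraph g h = symmDiff (discordanceGraph f g) (discordanceGraph f h) := by
  ext x y
  have := hf.ne (a₁ := x) (a₂ := y)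
  have := hg.ne (a₁ := x) (a₂ := y)
  have := hh.ne (a₁ := x) (a₂ := y)
  simp only [symmDiff, SimpleGraph.sup_adj, SimpleGraph.sdiff_adj, discordanceGraph_adj]
  grind

theorem discordanceGraph_adj_of_lt_of_lt (hg : Function.Injective g) (hxy : f x < f y)
    (hyz : f y < f z)
    (h : (discordanceGraph f g).Adj x y ↔ (discordanceGraph f g).Adj y z) :
    (discordanceGraph f g).Adj x z ↔ (discordanceGraph f g).Adj x y := by
  by_cases hadj : (discordanceGraph f g).Adj x y
  · have hyx := (discordanceGraph_adj_iff_of_lt hxy).mp hadj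
    have hzy := (discordanceGraph_adj_iff_of_lt hyz).mp (h.mp hadj)
    simp only [hadj, discordanceGraph_adj_iff_of_lt (hxy.trans hyz), hzy.trans hyx]
  · have hgxy := (not_discordanceGraph_adj_iff_of_lt hg hxy).mp hadj
    have hgyz := (not_discordanceGraph_adj_iff_of_lt hg hyz).mp (mt h.mpr hadj)
    simp only [hadj, discordanceGraph_adj_iff_of_lt (hxy.trans hyz), (hgxy.trans hgyz).not_gt]

-- Gallai's forcing relation: edges that share an endpoint and whose other ends are not adjacent are
-- oriented alike by every transitive orientation.
theorem lt_iff_lt_of_discordanceGraph_adj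
    (hxy : (discordanceGraph f g).Adj x y) (hzy : (discordanceGraph f g).Adj z y)
    (hxz : ¬ (discordanceGraph f g).Adj x z) : f x < f y ↔ f z < f y := by
  simp only [discordanceGraph_adj] at *
  grind

end

/-- Colours the pairs of vertices outside `E` by `0`, those in `E` but not in `D` by `1`, and those
in both by `2`. -/
noncomputable def nestedColoring (E D : SimpleGraph V) (p : Sym2 V) : Fin 3 :=
  open Classical in if p ∈ E.edgeSet then if p ∈ D.edgeSet then 2 else 1 else 0

theorem nestedColoring_eq_iff {E D : SimpleGraph V} {p q : Sym2 V} :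
    nestedColoring E D p = nestedColoring E D q ↔
      (p ∈ E.edgeSet ↔ q ∈ E.edgeSet) ∧
        (p ∈ E.edgeSet → (p ∈ D.edgeSet ↔ q ∈ D.edgeSet)) := by
  unfold nestedColoring
  grind

theorem eq_top_or_le_or_disjoint_of_colorGraph_nestedColoring {E D : SimpleGraph V} {c : Fin 3}
    (hc : colorGraph (nestedColoring E D) c = ⊥) : E = ⊤ ∨ E ≤ D ∨ Disjoint E D := by
  have color_ne {x y} (hxy : x ≠ y) : nestedColoring E D s(x, y) ≠ c := fun h =>
    SimpleGraph.eq_bot_iff_forall_not_adj.mp hc x y (colorGraph_adj.mpr ⟨h, hxy⟩)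
  fin_cases c
  · refine .inl (SimpleGraph.eq_top_iff_forall_ne_adj.mpr fun x y hxy => ?_)
    by_contra hE
    exact color_ne hxy (by simp [nestedColoring, hE])
  · refine .inr (.inl fun x y hE => ?_)
    by_contra hD
    exact color_ne hE.ne (by simp [nestedColoring, hE, hD])
  · refine .inr (.inr (disjoint_iff_inf_le.mpr fun x y h => ?_))
    obtain ⟨hE, hD⟩ := h
    exact color_ne hE.ne (by simp [nestedColoring, hE, hD])

variable {f₁ : V → α} {f₂ : V → β} {g₁ : V → α'} {g₂ : V → β'}

theorem rainbowFree_nestedColoring (hf₁ : Function.Injective f₁) (hg₁ : Function.Injective g₁)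
    (hE : discordanceGraph f₁ f₂ = discordanceGraph g₁ g₂) :
    RainbowFree (nestedColoring (discordanceGraph f₁ f₂) (discordanceGraph f₁ g₁)) := by
  set E := discordanceGraph f₁ f₂
  set D := discordanceGraph f₁ g₁ with hD
  have forcing {x y z} (hxy : E.Adj x y) (hzy : E.Adj z y) (hxz : ¬ E.Adj x z) :
      D.Adj x y ↔ D.Adj z y := by
    have hf := lt_iff_lt_of_discordanceGraph_adj hxy hzy hxz
    rw [hE] at hxy hzy hxz
    have hg := lt_iff_lt_of_discordanceGraph_adj hxy hzy hxz
    have := hf₁.ne hxy.ne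
    have := hf₁.ne hzy.ne
    have := hg₁.ne hxy.ne
    have := hg₁.ne hzy.ne
    simp only [hD, discordanceGraph_adj]
    grind
  intro x y z
  simp only [nestedColoring_eq_iff, SimpleGraph.mem_edgeSet]
  have := @forcing x y z
  have := @forcing y x z
  have := @forcing x z y
  grind [SimpleGraph.adj_comm]

theorem transitiveAlong_nestedColoring_fst (hf₂ : Function.Injective f₂)
    (hg₁ : Function.Injective g₁) :
    TransitiveAlong f₁ (nestedColoring (discordanceGraph f₁ f₂) (discordanceGraph f₁ g₁)) := by
  intro x y z hxy hyz
  simp only [nestedColoring_eq_iff, SimpleGraph.mem_edgeSet]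
  rintro ⟨hE, hD⟩
  have hE' := discordanceGraph_adj_of_lt_of_lt hf₂ hxy hyz hE
  exact ⟨hE', fun hxz =>
    discordanceGraph_adj_of_lt_of_lt hg₁ hxy hyz (hD (hE'.mp hxz))⟩

theorem transitiveAlong_nestedColoring_snd (hf₁ : Function.Injective f₁)
    (hg₁ : Function.Injective g₁) :
    TransitiveAlong f₂ (nestedColoring (discordanceGraph f₁ f₂) (discordanceGraph f₁ g₁)) := by
  intro x y z hxy hyz
  simp only [nestedColoring_eq_iff, SimpleGraph.mem_edgeSet, discordanceGraph_comm f₁ f₂]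
  rintro ⟨hE, hD⟩
  have hE' := discordanceGraph_adj_of_lt_of_lt hf₁ hxy hyz hE
  refine ⟨hE', fun hxz => ?_⟩
  have hxyE := hE'.mp hxz
  have hyx := (discordanceGraph_adj_iff_of_lt hxy).mp hxyE
  have hzy := (discordanceGraph_adj_iff_of_lt hyz).mp (hE.mp hxyE)
  have hD' := discordanceGraph_adj_of_lt_of_lt hg₁ hzy hyx
  grind [SimpleGraph.adj_comm]

end Discordance

section SimplePair

variable {V α β α' β' : Type*} [LinearOrder α] [LinearOrder β] [LinearOrder α'] [LinearOrder β']
  {f₁ : V ≃ α} {f₂ : V ≃ β} {g₁ : V → α'} {g₂ : V → β'}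

-- When `f₂` reverses the order of `f₁`, every interval of one order is an interval of the other.
theorem IsSimplePair.mem_Icc_of_discordanceGraph_eq_top (hsimple : IsSimplePair f₁ f₂)
    (htop : discordanceGraph f₁ f₂ = ⊤) {x y : V} (hxy : f₁ x < f₁ y) (v : V) :
    f₁ v ∈ Icc (f₁ x) (f₁ y) := by
  have lt_iff (a b) : f₂ a < f₂ b ↔ f₁ b < f₁ a := by
    have hab : f₁ a < f₁ b ∧ f₂ b < f₂ a ∨ f₁ b < f₁ a ∧ f₂ a < f₂ b ↔ a ≠ b := by
      rw [← discordanceGraph_adj, htop, SimpleGraph.top_adj]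
    grind
  have le_iff (a b) : f₂ a ≤ f₂ b ↔ f₁ b ≤ f₁ a := le_iff_le_iff_lt_iff_lt.mpr (lt_iff b a)
  let K : Set V := f₁ ⁻¹' Icc (f₁ x) (f₁ y)
  have hK₁ : f₁ '' K = Icc (f₁ x) (f₁ y) := f₁.image_preimage _
  have hK₂ : f₂ '' K = Icc (f₂ y) (f₂ x) := by
    ext w
    obtain ⟨u, rfl⟩ := f₂.surjective w
    simp [K, le_iff, and_comm]
  rcases hsimple K (hK₁ ▸ ordConnected_Icc) (hK₂ ▸ ordConnected_Icc) with h | h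
  · exact absurd (h ⟨le_rfl, hxy.le⟩ ⟨hxy.le, le_rfl⟩) fun h => hxy.ne (congrArg f₁ h)
  · exact h.ge (mem_univ v)

theorem IsSimplePair.eq_bot_or_eq_top_of_discordanceGraph_eq_top (hsimple : IsSimplePair f₁ f₂)
    (htop : discordanceGraph f₁ f₂ = ⊤) (G : SimpleGraph V) : G = ⊥ ∨ G = ⊤ := by
  refine or_iff_not_imp_left.mpr fun hG => ?_
  obtain ⟨x, y, hadj⟩ := SimpleGraph.ne_bot_iff_exists_adj.mp hG
  refine SimpleGraph.eq_top_iff_forall_ne_adj.mpr fun u v huv => ?_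
  wlog hxy : f₁ x < f₁ y generalizing x y
  · exact this y x hadj.symm (lt_of_le_of_ne (not_lt.mp hxy) (f₁.injective.ne hadj.ne'))
  wlog h : f₁ u < f₁ v generalizing u v
  · exact (this v u huv.symm (lt_of_le_of_ne (not_lt.mp h) (f₁.injective.ne huv.symm))).symm
  have mem_xy := hsimple.mem_Icc_of_discordanceGraph_eq_top htop hxy
  have mem_uv := hsimple.mem_Icc_of_discordanceGraph_eq_top htop h
  obtain rfl : x = u := f₁.injective (le_antisymm (mem_xy u).1 (mem_uv x).1)
  obtain rfl : y = v := f₁.injective (le_antisymm (mem_uv y).2 (mem_xy v).2)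
  exact hadj

theorem IsSimplePair.disjoint_or_le [Finite V] (hsimple : IsSimplePair f₁ f₂)
    (hg₁ : Function.Injective g₁) (hE : discordanceGraph f₁ f₂ = discordanceGraph g₁ g₂) :
    Disjoint (discordanceGraph f₁ f₂) (discordanceGraph f₁ g₁) ∨
      discordanceGraph f₁ f₂ ≤ discordanceGraph f₁ g₁ := by
  obtain ⟨c, hc⟩ := hsimple.exists_colorGraph_eq_bot
    (rainbowFree_nestedColoring f₁.injective hg₁ hE) (by simp)
    (transitiveAlong_nestedColoring_fst f₂.injective hg₁)
    (transitiveAlong_nestedColoring_snd f₁.injective hg₁)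
  rcases eq_top_or_le_or_disjoint_of_colorGraph_nestedColoring hc with htop | h | h
  · rcases hsimple.eq_bot_or_eq_top_of_discordanceGraph_eq_top htop (discordanceGraph f₁ g₁)
      with h | h
    · exact .inl (h ▸ disjoint_bot_right)
    · exact .inr (h ▸ le_top)
  · exact .inr h
  · exact .inl h

theorem IsSimplePair.discordanceGraph_eq [Finite V] (hsimple : IsSimplePair f₁ f₂)
    (hg₁ : Function.Injective g₁) (hg₂ : Function.Injective g₂)
    (hE : discordanceGraph f₁ f₂ = discordanceGraph g₁ g₂) :
    discordanceGraph f₁ g₁ = ⊥ ∨ discordanceGraph f₁ g₁ = ⊤ ∨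
      discordanceGraph f₁ g₁ = discordanceGraph f₁ f₂ ∨
      discordanceGraph f₁ g₁ = (discordanceGraph f₁ f₂)ᶜ := by
  have hdual : discordanceGraph f₁ (f₂.trans OrderDual.toDual) = (discordanceGraph f₁ f₂)ᶜ :=
    discordanceGraph_toDual (g := f₂) f₁.injective f₂.injective
  have hcompl := hsimple.trans_toDual.disjoint_or_le (g₂ := OrderDual.toDual ∘ g₂) hg₁
    (by rw [hdual, discordanceGraph_toDual hg₁ hg₂, hE])
  rw [hdual] at hcompl
  rcases hsimple.disjoint_or_le hg₁ hE with h | h <;> rcases hcompl with h' | h'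
  · exact .inl (le_bot_iff.mp ((le_inf h.symm.le_compl_right h'.symm.le_compl_right).trans
      inf_compl_eq_bot.le))
  · exact .inr <| .inr <| .inr <| le_antisymm h.symm.le_compl_right h'
  · exact .inr <| .inr <| .inl <| le_antisymm (disjoint_compl_left_iff.mp h') h
  · exact .inr <| .inl <| top_le_iff.mp (sup_compl_eq_top.symm.le.trans (sup_le h h'))

theorem strictMono_comp_symm (hg₁ : Function.Injective g₁) (h : discordanceGraph f₁ g₁ = ⊥) :
    StrictMono (g₁ ∘ f₁.symm) := fun a b hab =>
  (not_discordanceGraph_adj_iff_of_lt (f := f₁) hg₁ (by simpa using hab)).mp (by simp [h])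

theorem strictAnti_comp_symm (h : discordanceGraph f₁ g₁ = ⊤) :
    StrictAnti (g₁ ∘ f₁.symm) := fun a b hab =>
  (discordanceGraph_adj_iff_of_lt (f := f₁) (by simpa using hab)).mp (by simpa [h] using hab.ne)

theorem IsSimplePair.strictMono_or_strictAnti [Finite V] (hsimple : IsSimplePair f₁ f₂)
    (hg₁ : Function.Injective g₁) (hg₂ : Function.Injective g₂)
    (hE : discordanceGraph f₁ f₂ = discordanceGraph g₁ g₂) :
    StrictMono (g₁ ∘ f₁.symm) ∨ StrictAnti (g₁ ∘ f₁.symm) ∨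
      StrictMono (g₁ ∘ f₂.symm) ∨ StrictAnti (g₁ ∘ f₂.symm) := by
  have hsymm : discordanceGraph f₂ g₁ =
      symmDiff (discordanceGraph f₁ f₂) (discordanceGraph f₁ g₁) :=
    discordanceGraph_eq_symmDiff f₁.injective f₂.injective hg₁
  rcases hsimple.discordanceGraph_eq hg₁ hg₂ hE with hD | hD | hD | hD
  · exact .inl (strictMono_comp_symm hg₁ hD)
  · exact .inr <| .inl <| strictAnti_comp_symm hD
  · exact .inr <| .inr <| .inl <| strictMono_comp_symm hg₁ (by rw [hsymm, hD, symmDiff_self])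
  · exact .inr <| .inr <| .inr <| strictAnti_comp_symm (by rw [hsymm, hD, symmDiff_compl_self])

end SimplePair

namespace FinPerm

variable {σ π : FinPerm}

instance : IsPreorder FinPerm Contained where
  refl _ := ⟨id, strictMono_id, fun _ _ => Iff.rfl⟩
  trans := by
    rintro _ _ _ ⟨f, hf, hfiff⟩ ⟨g, hg, hgiff⟩
    exact ⟨g ∘ f, hg.comp hf, fun i j => (hfiff i j).trans (hgiff _ _)⟩

theorem contained_of_strictMono {f : Fin σ.1 → Fin π.1} (hf : StrictMono f)
    (hadj : inversionGraph σ = (inversionGraph π).comap f) : Contained σ π := by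
  refine ⟨f, hf, fun i j => ?_⟩
  have hij : (discordanceGraph id σ.2).Adj i j ↔ (discordanceGraph id π.2).Adj (f i) (f j) :=
    Iff.of_eq (congrArg (fun G => G.Adj i j) hadj)
  rcases lt_trichotomy i j with h | rfl | h
  · rw [← not_discordanceGraph_adj_iff_of_lt (f := id) σ.2.injective h, hij,
      not_discordanceGraph_adj_iff_of_lt π.2.injective (hf h)]
  · simp only [lt_irrefl]
  · rw [← discordanceGraph_adj_iff_of_lt (f := id) h, SimpleGraph.adj_comm, hij,
      SimpleGraph.adj_comm, discordanceGraph_adj_iff_of_lt (f := id) (hf h)]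

/-- The inverse permutation, whose plot is the reflection of the plot of `π` in the diagonal. -/
def inverse (π : FinPerm) : FinPerm :=
  ⟨π.1, π.2.symm⟩

/-- The reverse complement of `π`: its plot is the plot of `π` rotated by a half turn. -/
def reverseComplement (π : FinPerm) : FinPerm :=
  ⟨π.1, (Fin.revPerm.trans π.2).trans Fin.revPerm⟩

theorem inverse_involutive : Function.Involutive inverse := fun _ => rfl

theorem reverseComplement_involutive : Function.Involutive reverseComplement := fun π =>
  Sigma.ext rfl (heq_of_eq (Equiv.ext fun (i : Fin π.1) => by
    change (π.2 i.rev.rev).rev.rev = π.2 i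
    simp only [Fin.rev_rev]))

theorem reverseComplement_inverse (π : FinPerm) :
    reverseComplement (inverse π) = inverse (reverseComplement π) := rfl

theorem Contained.inverse (h : Contained σ π) : Contained (inverse σ) (inverse π) := by
  obtain ⟨f, hf, hlt⟩ := h
  refine ⟨π.2 ∘ f ∘ σ.2.symm,
    fun (i j : Fin σ.1) (hij : i < j) => (hlt _ _).mp (by simpa using hij),
    fun (i j : Fin σ.1) => ?_⟩
  change σ.2.symm i < σ.2.symm j ↔
    π.2.symm (π.2 (f (σ.2.symm i))) < π.2.symm (π.2 (f (σ.2.symm j)))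
  rw [Equiv.symm_apply_apply, Equiv.symm_apply_apply, hf.lt_iff_lt]

theorem Contained.reverseComplement (h : Contained σ π) :
    Contained (reverseComplement σ) (reverseComplement π) := by
  obtain ⟨f, hf, hlt⟩ := h
  refine ⟨Fin.rev ∘ f ∘ Fin.rev,
    fun (i j : Fin σ.1) hij => Fin.rev_lt_rev.mpr (hf (Fin.rev_lt_rev.mpr hij)),
    fun (i j : Fin σ.1) => ?_⟩
  change (σ.2 i.rev).rev < (σ.2 j.rev).rev ↔
    (π.2 (f i.rev).rev.rev).rev < (π.2 (f j.rev).rev.rev).rev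
  simp only [Fin.rev_lt_rev, Fin.rev_rev, hlt]

theorem inversionGraph_inverse (π : FinPerm) :
    inversionGraph (inverse π) = (inversionGraph π).comap π.2.symm := by
  change discordanceGraph id π.2.symm = discordanceGraph π.2.symm (π.2 ∘ π.2.symm)
  rw [Equiv.self_comp_symm, discordanceGraph_comm]

theorem inversionGraph_reverseComplement (π : FinPerm) :
    inversionGraph (reverseComplement π) = (inversionGraph π).comap Fin.rev := by
  change discordanceGraph id (Fin.rev ∘ π.2 ∘ Fin.rev) = discordanceGraph Fin.rev (π.2 ∘ Fin.rev)
  ext i j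
  simp only [discordanceGraph_adj, id_eq, Function.comp_apply, Fin.rev_lt_rev, or_comm]

theorem IsSimple.isSimplePair (hπ : π.IsSimple) : IsSimplePair (Equiv.refl _) π.2 := by
  intro K hpos hval
  rw [Equiv.coe_refl, image_id] at hpos
  rcases hπ.2 K ⟨hpos, hval⟩ with h | h | h
  · exact .inl (ncard_le_one_iff_subsingleton.mp (by lia))
  · exact .inl (ncard_le_one_iff_subsingleton.mp h.le)
  · exact .inr ((eq_univ_iff_ncard K).mpr (by simpa using h))

theorem IsSimple.upToInvolution_contained (hσ : σ.IsSimple)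
    (h : (inversionGraph σ).IsIndContained (inversionGraph π)) :
    UpToInvolution (UpToInvolution Contained inverse) reverseComplement σ π := by
  obtain ⟨φ⟩ := h
  obtain ⟨f, hinj, hadj⟩ : ∃ f : Fin σ.1 → Fin π.1,
      f.Injective ∧ inversionGraph σ = (inversionGraph π).comap f :=
    ⟨φ, φ.injective, φ.comap_eq.symm⟩
  have hrev {τ : FinPerm} {g : Fin τ.1 → Fin π.1}
      (h : inversionGraph τ = (inversionGraph π).comap g) :
      inversionGraph (reverseComplement τ) = (inversionGraph π).comap (g ∘ Fin.rev) :=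
    (inversionGraph_reverseComplement τ).trans (congrArg (SimpleGraph.comap Fin.rev) h)
  have hinv : inversionGraph (inverse σ) = (inversionGraph π).comap (f ∘ σ.2.symm) :=
    (inversionGraph_inverse σ).trans (congrArg (SimpleGraph.comap σ.2.symm) hadj)
  rcases hσ.isSimplePair.strictMono_or_strictAnti hinj (π.2.injective.comp hinj) hadj
    with hf | hf | hf | hf
  · exact .inl (.inl (contained_of_strictMono hf hadj))
  · exact .inr (.inl (contained_of_strictMono (hf.comp Fin.rev_strictAnti) (hrev hadj)))
  · exact .inl (.inr (contained_of_strictMono hf hinv))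
  · refine .inr (.inr ?_)
    rw [← reverseComplement_inverse]
    exact contained_of_strictMono (hf.comp Fin.rev_strictAnti) (hrev hinv)

end FinPerm

theorem mainTheorem12_general (X : Set FinPerm)
    (hG : (FinPerm.graphClass X).PartiallyWellOrderedOn FinGraph.InducedSubgraph) :
    {σ : FinPerm | σ ∈ X ∧ FinPerm.IsSimple σ}.PartiallyWellOrderedOn FinPerm.Contained := by
  have contained_inverse : ∀ σ π, FinPerm.Contained σ π → FinPerm.Contained σ.inverse π.inverse :=
    fun _ _ => FinPerm.Contained.inverse
  have := UpToInvolution.isPreorder FinPerm.inverse_involutive contained_inverse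
  refine partiallyWellOrderedOn_of_upToInvolution FinPerm.inverse_involutive contained_inverse ?_
  refine partiallyWellOrderedOn_of_upToInvolution FinPerm.reverseComplement_involutive ?_ ?_
  · rintro σ π (h | h)
    · exact .inl h.reverseComplement
    · exact .inr (FinPerm.reverseComplement_inverse σ ▸ h.reverseComplement)
  · rw [partiallyWellOrderedOn_iff_exists_lt]
    intro π hπ
    obtain ⟨m, n, hmn, hind⟩ := hG.exists_lt
      (f := fun n => ⟨(π n).1, FinPerm.inversionGraph (π n)⟩)
      fun n => ⟨π n, (hπ n).1, ⟨SimpleGraph.Iso.refl⟩⟩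
    exact ⟨m, n, hmn, (hπ m).2.upToInvolution_contained hind⟩

theorem mainTheorem12 (C : Set FinPerm) (hC : FinPerm.IsClass C)
    (hG : (FinPerm.graphClass C).PartiallyWellOrderedOn FinGraph.InducedSubgraph) :
    {σ : FinPerm | σ ∈ C ∧ FinPerm.IsSimple σ}.PartiallyWellOrderedOn FinPerm.Contained :=
  mainTheorem12_general C hG
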